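/- Let $X,Y\subset\mathbb{R}^d$ be finite sets and let $r\ge 0$. For a finite set $Z\subset\mathbb{R}^d$ and $z\in Z$, let $$\mathrm{Vor}_r(z,Z)=\{p\in\mathbb{R}^d : \|p-z\|\le r \text{ and } \|p-z\|\le\|p-z'\| \text{ for all } z'\in Z\}$$ be the Voronoi ball of $z$ with respect to $Z$. The nerve of a finite family of sets $(U_i)_{i\in I}$ is the abstract simplicial complex whose simplexes are the nonempty subsets $J\subset I$ with $\bigcap_{i\in J}U_i\neq\emptyset$. The alpha complex $\mathcal{A}_r(Z)$ is the nerve of the family $(\mathrm{Vor}_r(z,Z))_{z\in Z}$. The coupled alpha complex $\mathcal{A}^{\mathrm{co}}_r(X,Y)$ is the nerve of the combined family consisting of the sets $\mathrm{Vor}_r(x,X)$, $x\in X$, and the sets $\mathrm{Vor}_r(y,Y)$, $y\in Y$, indexed by the disjoint union $X\sqcup Y$. Then $$\mathcal{A}^{\mathrm{co}}_r(X,Y)\simeq\mathcal{A}_r(X\cup Y),$$ that is, the geometric realizations of these two simplicial complexes are homotopy equivalent topological spaces. -/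

import Mathlib

open scoped ContinuousMap

namespace CoupledAlpha

/-- The nerve of a family of sets `U : ι → Set α`: its vertices are indices and its simplexes are
the (nonempty) finite sets `J` of indices with `⋂ i ∈ J, U i ≠ ∅`. -/
def nerve {α ι : Type*} (U : ι → Set α) : PreAbstractSimplicialComplex ι where
  faces := {J | J.Nonempty ∧ (⋂ i ∈ J, U i).Nonempty}
  isRelLowerSet_faces := by
    rintro J ⟨hJ, z, hz⟩
    refine ⟨hJ, fun J' hJ' hne => ⟨hne, z, ?_⟩⟩
    simp only [Set.mem_iInter] at hz ⊢
    exact fun i hi => hz i (hJ' hi)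

/-- The geometric realization of an abstract simplicial complex on a finite vertex type, as a subset
of `ι → ℝ`: barycentric coordinates supported on a simplex. It carries the subspace topology. -/
def realization {ι : Type*} [Fintype ι] (K : PreAbstractSimplicialComplex ι) : Set (ι → ℝ) :=
  {f | f ∈ stdSimplex ℝ ι ∧ ∃ s ∈ K.faces, ∀ i, i ∉ s → f i = 0}

section

variable {M : Type*} [MetricSpace M]

/-- The Voronoi cell of `x` with respect to `X`. -/
def voronoiCell (X : Finset M) (x : M) : Set M :=
  {z | ∀ x' ∈ X, dist x z ≤ dist x' z}

/-- The Voronoi ball of radius `r` of `x` with respect to `X`. -/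
def voronoiBall (r : ℝ) (X : Finset M) (x : M) : Set M :=
  Metric.closedBall x r ∩ voronoiCell X x

/-- The alpha complex of `X` with parameter `r`: the nerve of the Voronoi balls of `X`. -/
def alphaComplex (r : ℝ) (X : Finset M) : PreAbstractSimplicialComplex X :=
  nerve fun x : X => voronoiBall r X (x : M)

/-- The coupled alpha complex of `X` and `Y` with parameter `r`: the nerve of the Voronoi balls of
`X` (with respect to `X`) together with the Voronoi balls of `Y` (with respect to `Y`). -/
def coupledAlphaComplex (r : ℝ) (X Y : Finset M) : PreAbstractSimplicialComplex (X ⊕ Y) :=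
  nerve (Sum.elim (fun x : X => voronoiBall r X (x : M)) (fun y : Y => voronoiBall r Y (y : M)))

end

end CoupledAlpha

/-!
The proof rests on a nerve theorem: if `U` is a finite family of open convex sets in a normed space,
then the realization of its nerve is homotopy equivalent to `⋃ i, U i`
(`nonempty_homotopyEquiv_realization_nerve`).

Both maps of that equivalence are explicit. From the union to the nerve, a point is sent to the
normalized values of continuous functions `φ i` that are positive exactly on `U i`. In the other
direction, choose a point `p J ∈ ⋂ i ∈ J, U i` for each simplex `J`, and send barycentric
coordinates `t` to a weighted mean of the points `p J`. The weights (`sandwichWeight`) are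
continuous in `t` and vanish unless `{i | c < t i} ⊆ J ⊆ {i | t i ≠ 0}`, with the threshold
`c = 1 / (2 * card ι)`, which is small enough that `{i | c < t i}` is never empty. Therefore the mean
lies in `U i` whenever `c < t i` (`nerveToUnion_mem`), and this makes both compositions homotopic
to the identity through straight lines: on the union directly, and on the nerve in two steps, the
intermediate map being `t ↦ max (t i - c) 0`, normalized, which is supported on `{i | c < t i}`.

Voronoi balls are compact and convex but not open. For all small `ε > 0`, passing to
`ε`-thickenings makes them open and convex without changing the nerve
(`eventually_nerve_thickening_eq`). The Voronoi balls of a finite set `Z` cover exactly the union of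
the closed `r`-balls around `Z` (`iUnion_voronoiBall`), so the thickened families belonging to
`X ⊔ Y` and to `X ∪ Y` have the same union, and the two nerves are homotopy equivalent to it.
-/

namespace CoupledAlpha

open Set Metric Filter Topology

/-! ### Straight-line homotopies and normalization -/

/-- Two maps into a subset `S` of a topological vector space are homotopic as soon as the segments
between their values stay in `S`. -/
theorem homotopic_of_segment_subset {X E : Type*} [TopologicalSpace X] [AddCommGroup E] [Module ℝ E]
    [TopologicalSpace E] [IsTopologicalAddGroup E] [ContinuousSMul ℝ E] {S : Set E} (f g : C(X, S))
    (h : ∀ x, segment ℝ (f x : E) (g x) ⊆ S) : f.Homotopic g := by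
  refine ⟨{
    toFun := fun q => ⟨(1 - (q.1 : ℝ)) • (f q.2 : E) + (q.1 : ℝ) • (g q.2 : E),
      h q.2 ⟨1 - q.1, q.1, sub_nonneg.2 q.1.2.2, q.1.2.1, by ring, rfl⟩⟩
    continuous_toFun := by fun_prop
    map_zero_left := fun x => by simp
    map_one_left := fun x => by simp }⟩

/-- A tuple of reals divided by its sum. -/
noncomputable def normalize {ι : Type*} [Fintype ι] (f : ι → ℝ) : ι → ℝ :=
  fun i => f i / ∑ j, f j

theorem normalize_mem_stdSimplex {ι : Type*} [Fintype ι] {f : ι → ℝ} (h0 : ∀ i, 0 ≤ f i)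
    (hs : ∑ j, f j ≠ 0) : normalize f ∈ stdSimplex ℝ ι :=
  ⟨fun i => div_nonneg (h0 i) (Finset.sum_nonneg fun j _ => h0 j), by
    simp only [normalize]
    rw [← Finset.sum_div, div_self hs]⟩

theorem sum_ne_zero_of_pos {ι : Type*} [Fintype ι] {f : ι → ℝ} (h0 : ∀ i, 0 ≤ f i)
    (h : ∃ i, 0 < f i) : ∑ j, f j ≠ 0 :=
  let ⟨i, hi⟩ := h
  (Finset.sum_pos' (fun j _ => h0 j) ⟨i, Finset.mem_univ i, hi⟩).ne'

theorem continuous_normalize {X ι : Type*} [TopologicalSpace X] [Fintype ι] {f : X → ι → ℝ}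
    (hf : Continuous f) (hs : ∀ x, ∑ j, f x j ≠ 0) : Continuous fun x => normalize (f x) := by
  unfold normalize
  exact continuous_pi fun i => Continuous.div (by fun_prop) (by fun_prop) hs

theorem segment_subset_realization {ι : Type*} [Fintype ι] {K : PreAbstractSimplicialComplex ι}
    {f g : ι → ℝ} {s : Finset ι} (hs : s ∈ K.faces) (hf : f ∈ stdSimplex ℝ ι)
    (hg : g ∈ stdSimplex ℝ ι) (hf0 : ∀ i, i ∉ s → f i = 0) (hg0 : ∀ i, i ∉ s → g i = 0) :
    segment ℝ f g ⊆ realization K := by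
  intro q hq
  refine ⟨(convex_stdSimplex ℝ ι).segment_subset hf hg hq, s, hs, fun i hi => ?_⟩
  obtain ⟨a, b, -, -, -, rfl⟩ := hq
  simp [hf0 i hi, hg0 i hi]

/-! ### Truncated barycentric coordinates -/

section Weights

variable {ι : Type*} [Fintype ι]

variable (ι) in
/-- Half the average of barycentric coordinates indexed by `ι` (and `0` if `ι` is empty). -/
noncomputable def threshold : ℝ := 1 / (2 * Fintype.card ι)

theorem threshold_nonneg : 0 ≤ threshold ι := by unfold threshold; positivity

theorem exists_threshold_lt {t : ι → ℝ} (ht : t ∈ stdSimplex ℝ ι) : ∃ i, threshold ι < t i := by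
  by_contra! h
  have h1 : ∑ i, t i ≤ Fintype.card ι * threshold ι := by
    simpa using Finset.sum_le_sum fun i (_ : i ∈ Finset.univ) => h i
  rw [ht.2, threshold] at h1
  rcases Nat.eq_zero_or_pos (Fintype.card ι) with h0 | h0
  · norm_num [h0] at h1
  · have : (0 : ℝ) < Fintype.card ι := by exact_mod_cast h0
    field_simp at h1
    norm_num at h1

/-- Barycentric coordinates cut down by the threshold and normalized: a point supported on the
coordinates of `t` that exceed the threshold. -/
noncomputable def truncation (t : ι → ℝ) : ι → ℝ :=
  normalize fun i => max (t i - threshold ι) 0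

theorem truncation_sum_ne_zero {t : ι → ℝ} (ht : t ∈ stdSimplex ℝ ι) :
    ∑ i, max (t i - threshold ι) 0 ≠ 0 :=
  let ⟨i, hi⟩ := exists_threshold_lt ht
  sum_ne_zero_of_pos (fun _ => le_max_right _ _) ⟨i, lt_max_of_lt_left (sub_pos.2 hi)⟩

theorem truncation_mem_stdSimplex {t : ι → ℝ} (ht : t ∈ stdSimplex ℝ ι) :
    truncation t ∈ stdSimplex ℝ ι :=
  normalize_mem_stdSimplex (fun _ => le_max_right _ _) (truncation_sum_ne_zero ht)

theorem truncation_eq_zero {t : ι → ℝ} {i : ι} (h : t i ≤ threshold ι) : truncation t i = 0 := by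
  simp [truncation, normalize, h]

open Classical in
/-- The weight of the index set `J` at `t`. It vanishes unless `J` lies between the set of indices
whose coordinate exceeds the threshold and the support of `t`. -/
noncomputable def sandwichWeight (t : ι → ℝ) (J : Finset ι) : ℝ :=
  (∏ j ∈ J, t j) * ∏ i ∈ Jᶜ, max (threshold ι - t i) 0

theorem sandwichWeight_nonneg {t : ι → ℝ} (ht : ∀ i, 0 ≤ t i) (J : Finset ι) :
    0 ≤ sandwichWeight t J :=
  mul_nonneg (Finset.prod_nonneg fun j _ => ht j) (Finset.prod_nonneg fun _ _ => le_max_right _ _)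

theorem ne_zero_of_sandwichWeight_ne_zero {t : ι → ℝ} {J : Finset ι} (h : sandwichWeight t J ≠ 0)
    {j : ι} (hj : j ∈ J) : t j ≠ 0 :=
  Finset.prod_ne_zero_iff.1 (left_ne_zero_of_mul h) j hj

theorem mem_of_sandwichWeight_ne_zero {t : ι → ℝ} {J : Finset ι} (h : sandwichWeight t J ≠ 0)
    {i : ι} (hi : threshold ι < t i) : i ∈ J := by
  classical
  by_contra hJ
  refine Finset.prod_ne_zero_iff.1 (right_ne_zero_of_mul h) i ?_ (max_eq_right (by linarith))
  simpa using hJ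

theorem sum_sandwichWeight_pos {t : ι → ℝ} (ht : t ∈ stdSimplex ℝ ι) :
    0 < ∑ J, sandwichWeight t J := by
  classical
  -- The set of indices whose coordinate reaches the threshold has positive weight.
  refine Finset.sum_pos' (fun J _ => sandwichWeight_nonneg ht.1 J)
    ⟨Finset.univ.filter fun i => threshold ι ≤ t i, Finset.mem_univ _, ?_⟩
  obtain ⟨k, -⟩ := exists_threshold_lt ht
  have hpos : 0 < threshold ι := by
    have : (0 : ℝ) < Fintype.card ι := by exact_mod_cast Fintype.card_pos_iff.2 ⟨k⟩
    unfold threshold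
    positivity
  refine mul_pos (Finset.prod_pos fun j hj => ?_) (Finset.prod_pos fun i hi => ?_)
  · exact hpos.trans_le (Finset.mem_filter.1 hj).2
  · have : t i < threshold ι := by simpa using hi
    exact lt_max_of_lt_left (sub_pos.2 this)

theorem continuous_sandwichWeight (J : Finset ι) :
    Continuous fun t : ι → ℝ => sandwichWeight t J := by
  unfold sandwichWeight
  fun_prop

end Weights

/-! ### The nerve theorem for open convex sets -/

/-- An open set in a metric space is the positivity set of a nonnegative continuous function. -/
theorem exists_continuous_pos_iff_mem {M : Type*} [MetricSpace M] {U : Set M} (hU : IsOpen U) :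
    ∃ f : M → ℝ, Continuous f ∧ (∀ x, 0 ≤ f x) ∧ ∀ x, 0 < f x ↔ x ∈ U := by
  rcases eq_empty_or_nonempty Uᶜ with h | h
  · exact ⟨fun _ => 1, continuous_const, fun _ => zero_le_one, fun x => by
      simp [compl_empty_iff.1 h]⟩
  · refine ⟨fun x => infDist x Uᶜ, continuous_infDist_pt _, fun _ => infDist_nonneg, fun x => ?_⟩
    rw [← hU.isClosed_compl.notMem_iff_infDist_pos h, notMem_compl_iff]

open Classical in
theorem filter_mem_nerve_faces {ι α : Type*} [Fintype ι] {U : ι → Set α} {x : α}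
    (hx : x ∈ ⋃ i, U i) :
    Finset.univ.filter (fun i => x ∈ U i) ∈ (nerve U).faces := by
  obtain ⟨i, hi⟩ := mem_iUnion.1 hx
  exact ⟨⟨i, by simpa using hi⟩, x, by simp⟩

open Classical in
/-- A point of `⋂ i ∈ J, U i`, and `0` if there is none. -/
noncomputable def nervePoint {ι E : Type*} [Zero E] (U : ι → Set E) (J : Finset ι) : E :=
  if h : (⋂ i ∈ J, U i).Nonempty then h.some else 0

theorem nervePoint_mem {ι E : Type*} [Zero E] {U : ι → Set E} {J : Finset ι}
    (h : (⋂ i ∈ J, U i).Nonempty) {i : ι} (hi : i ∈ J) : nervePoint U J ∈ U i := by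
  rw [nervePoint, dif_pos h]
  exact mem_iInter₂.1 h.some_mem i hi

section Nerve

variable {ι E : Type*} [Fintype ι] [NormedAddCommGroup E] [NormedSpace ℝ E]

/-- The mean of the chosen points of the simplexes, with the sandwich weights of `t`. -/
noncomputable def nerveToUnion (U : ι → Set E) (t : ι → ℝ) : E :=
  Finset.univ.centerMass (sandwichWeight t) (nervePoint U)

theorem nerveToUnion_mem {U : ι → Set E} (hc : ∀ i, Convex ℝ (U i)) {t : ι → ℝ}
    (ht : t ∈ realization (nerve U)) {i : ι} (hi : threshold ι < t i) :
    nerveToUnion U t ∈ U i := by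
  classical
  obtain ⟨ht, s, hs, hts⟩ := ht
  rw [nerveToUnion, ← Finset.centerMass_filter_ne_zero]
  refine (hc i).centerMass_mem (fun J _ => sandwichWeight_nonneg ht.1 J) ?_ fun J hJ => ?_
  · rw [Finset.sum_filter_ne_zero]
    exact sum_sandwichWeight_pos ht
  · have hJ := (Finset.mem_filter.1 hJ).2
    have hiJ := mem_of_sandwichWeight_ne_zero hJ hi
    have hJs : J ⊆ s := fun j hj => by
      by_contra hjs
      exact ne_zero_of_sandwichWeight_ne_zero hJ hj (hts j hjs)
    exact nervePoint_mem ((nerve U).isRelLowerSet_faces hs |>.2 hJs ⟨i, hiJ⟩).2 hiJ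

theorem continuousOn_nerveToUnion (U : ι → Set E) :
    ContinuousOn (nerveToUnion U) (stdSimplex ℝ ι) := by
  unfold nerveToUnion Finset.centerMass
  refine ContinuousOn.smul (ContinuousOn.inv₀ ?_ fun t ht => (sum_sandwichWeight_pos ht).ne') ?_
  · exact (continuous_finsetSum _ fun J _ => continuous_sandwichWeight J).continuousOn
  · exact (continuous_finsetSum _ fun J _ =>
      (continuous_sandwichWeight J).smul continuous_const).continuousOn

/-- Nerve theorem: the nerve of a finite family of open convex sets is homotopy equivalent to the
union of the family. -/
theorem nonempty_homotopyEquiv_realization_nerve (U : ι → Set E) (ho : ∀ i, IsOpen (U i))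
    (hc : ∀ i, Convex ℝ (U i)) :
    Nonempty (↥(realization (nerve U)) ≃ₕ ↥(⋃ i, U i)) := by
  classical
  choose φ hφc hφ0 hφ using fun i => exists_continuous_pos_iff_mem (ho i)
  have hsum : ∀ x : ↥(⋃ i, U i), ∑ i, φ i x ≠ 0 := fun x =>
    sum_ne_zero_of_pos (fun i => hφ0 i x)
      ((mem_iUnion.1 x.2).imp fun i hi => (hφ i x).2 hi)
  have hψ1 : ∀ x : ↥(⋃ i, U i), normalize (fun i => φ i x) ∈ stdSimplex ℝ ι := fun x =>
    normalize_mem_stdSimplex (fun i => hφ0 i x) (hsum x)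
  have hψ0 : ∀ (x : ↥(⋃ i, U i)) (i : ι), (x : E) ∉ U i → normalize (fun i => φ i x) i = 0 := by
    intro x i hi
    have : φ i x = 0 := le_antisymm (not_lt.1 fun h => hi ((hφ i x).1 h)) (hφ0 i x)
    simp [normalize, this]
  let ψ : C(↥(⋃ i, U i), ↥(realization (nerve U))) :=
    { toFun := fun x => ⟨normalize fun i => φ i x, hψ1 x, _, filter_mem_nerve_faces x.2,
        fun i hi => hψ0 x i (by simpa using hi)⟩
      continuous_toFun :=
        (continuous_normalize (by fun_prop) hsum).subtype_mk _ }
  let Γ : C(↥(realization (nerve U)), ↥(⋃ i, U i)) :=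
    { toFun := fun t => ⟨nerveToUnion U t,
        let ⟨i, hi⟩ := exists_threshold_lt t.2.1
        mem_iUnion.2 ⟨i, nerveToUnion_mem hc t.2 hi⟩⟩
      continuous_toFun := ((continuousOn_nerveToUnion U).comp_continuous
        continuous_subtype_val fun t => t.2.1).subtype_mk _ }
  let ρ : C(↥(realization (nerve U)), ↥(realization (nerve U))) :=
    { toFun := fun t => ⟨truncation t, truncation_mem_stdSimplex t.2.1, by
        obtain ⟨s, hs, hts⟩ := t.2.2
        exact ⟨s, hs, fun i hi => truncation_eq_zero ((hts i hi).trans_le threshold_nonneg)⟩⟩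
      continuous_toFun := (continuous_normalize
        (f := fun (t : ↥(realization (nerve U))) i => max ((t : ι → ℝ) i - threshold ι) 0)
        (continuous_pi fun i =>
          (((continuous_apply i).comp continuous_subtype_val).sub continuous_const).max continuous_const)
        fun t => truncation_sum_ne_zero t.2.1).subtype_mk _ }
  refine ⟨⟨Γ, ψ, ?_, ?_⟩⟩
  · refine ContinuousMap.Homotopic.trans (g := ρ) ?_ ?_
    · -- Both ends are supported on the simplex of all `i` with `Γ t ∈ U i`.
      refine homotopic_of_segment_subset _ _ fun t => ?_
      refine segment_subset_realization (filter_mem_nerve_faces (Γ t).2) (hψ1 (Γ t)) (ρ t).2.1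
        (fun i hi => hψ0 (Γ t) i (by simpa using hi)) fun i hi => truncation_eq_zero ?_
      by_contra! h
      exact hi (Finset.mem_filter.2 ⟨Finset.mem_univ i, nerveToUnion_mem hc t.2 h⟩)
    · -- Truncation does not enlarge the support.
      refine homotopic_of_segment_subset _ _ fun t => ?_
      obtain ⟨s, hs, hts⟩ := t.2.2
      exact segment_subset_realization hs (ρ t).2.1 t.2.1
        (fun i hi => truncation_eq_zero ((hts i hi).trans_le threshold_nonneg)) hts
  · -- If the `i`-th coordinate of `ψ x` exceeds the threshold, then `U i` contains both ends.
    refine homotopic_of_segment_subset _ _ fun x => ?_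
    obtain ⟨i, hi⟩ := exists_threshold_lt (ψ x).2.1
    have hx : (x : E) ∈ U i := by
      by_contra h
      exact (threshold_nonneg.trans_lt hi).ne' (hψ0 x i h)
    exact ((hc i).segment_subset (nerveToUnion_mem hc (ψ x).2 hi) hx).trans (subset_iUnion U i)

end Nerve

/-! ### Thickening compact sets -/

theorem eventually_nonempty_biInter_of_thickening {ι M : Type*} [MetricSpace M] [ProperSpace M]
    {C : ι → Set M} (hC : ∀ i, IsCompact (C i)) {J : Finset ι} (hJ : J.Nonempty) :
    ∀ᶠ ε in 𝓝[>] (0 : ℝ), (⋂ i ∈ J, thickening ε (C i)).Nonempty → (⋂ i ∈ J, C i).Nonempty := by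
  by_cases h : (⋂ i ∈ J, C i).Nonempty
  · exact Eventually.of_forall fun _ _ => h
  obtain ⟨i₀, hi₀⟩ := hJ
  -- The closed thickenings have compact intersections, decreasing to `⋂ i ∈ J, C i`.
  suffices ∃ δ : {δ : ℝ // 0 < δ}, ¬ (⋂ i ∈ J, cthickening δ (C i)).Nonempty by
    obtain ⟨⟨δ, hδ⟩, hne⟩ := this
    filter_upwards [Ioo_mem_nhdsGT hδ] with ε hε hne'
    exact absurd (hne'.mono (iInter₂_mono fun i _ =>
      (thickening_subset_cthickening _ _).trans (cthickening_mono hε.2.le _))) hne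
  by_contra! hne
  have hclosed : ∀ δ : {δ : ℝ // 0 < δ}, IsClosed (⋂ i ∈ J, cthickening (δ : ℝ) (C i)) :=
    fun δ => isClosed_biInter fun _ _ => isClosed_cthickening
  have : Nonempty {δ : ℝ // 0 < δ} := ⟨⟨1, one_pos⟩⟩
  obtain ⟨x, hx⟩ := IsCompact.nonempty_iInter_of_directed_nonempty_isCompact_isClosed
    (fun δ : {δ : ℝ // 0 < δ} => ⋂ i ∈ J, cthickening (δ : ℝ) (C i))
    (fun a b => ⟨⟨min a b, lt_min a.2 b.2⟩,
      iInter₂_mono fun i _ => cthickening_mono (min_le_left _ _) _,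
      iInter₂_mono fun i _ => cthickening_mono (min_le_right _ _) _⟩)
    hne (fun δ => (hC i₀).cthickening.of_isClosed_subset (hclosed δ) (biInter_subset_of_mem hi₀))
    hclosed
  refine h ⟨x, mem_iInter₂.2 fun i hi => ?_⟩
  rw [← (hC i).isClosed.closure_eq, closure_eq_iInter_cthickening]
  exact mem_iInter₂.2 fun δ hδ => mem_iInter₂.1 (mem_iInter.1 hx ⟨δ, hδ⟩) i hi

/-- Thickening the members of a finite family of compact sets by a small amount does not change its
nerve. -/
theorem eventually_nerve_thickening_eq {ι M : Type*} [Finite ι] [MetricSpace M] [ProperSpace M]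
    {C : ι → Set M} (hC : ∀ i, IsCompact (C i)) :
    ∀ᶠ ε in 𝓝[>] (0 : ℝ), nerve (fun i => thickening ε (C i)) = nerve C := by
  have h : ∀ᶠ ε in 𝓝[>] (0 : ℝ), ∀ J : Finset ι, J.Nonempty →
      (⋂ i ∈ J, thickening ε (C i)).Nonempty → (⋂ i ∈ J, C i).Nonempty :=
    eventually_all.2 fun J => eventually_imp_distrib_left.2
      (eventually_nonempty_biInter_of_thickening hC)
  filter_upwards [h, self_mem_nhdsWithin] with ε hε hpos
  ext J
  exact ⟨fun hJ => ⟨hJ.1, hε J hJ.1 hJ.2⟩, fun hJ => ⟨hJ.1, hJ.2.mono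
    (iInter₂_mono fun i _ => self_subset_thickening hpos _)⟩⟩

/-- Two finite families of compact convex sets with the same union have homotopy equivalent nerves:
both nerves are homotopy equivalent to a small thickening of the union. -/
theorem nonempty_homotopyEquiv_realization_nerve_of_iUnion_eq {ι κ E : Type*} [Fintype ι]
    [Fintype κ] [NormedAddCommGroup E] [NormedSpace ℝ E] [ProperSpace E] {C : ι → Set E}
    {D : κ → Set E} (hC : ∀ i, IsCompact (C i)) (hC' : ∀ i, Convex ℝ (C i))
    (hD : ∀ k, IsCompact (D k)) (hD' : ∀ k, Convex ℝ (D k)) (h : ⋃ i, C i = ⋃ k, D k) :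
    Nonempty (↥(realization (nerve C)) ≃ₕ ↥(realization (nerve D))) := by
  obtain ⟨ε, h1, h2⟩ :=
    ((eventually_nerve_thickening_eq hC).and (eventually_nerve_thickening_eq hD)).exists
  obtain ⟨e1⟩ := nonempty_homotopyEquiv_realization_nerve (fun i => thickening ε (C i))
    (fun _ => isOpen_thickening) fun i => (hC' i).thickening ε
  obtain ⟨e2⟩ := nonempty_homotopyEquiv_realization_nerve (fun k => thickening ε (D k))
    (fun _ => isOpen_thickening) fun k => (hD' k).thickening ε
  rw [h1, ← thickening_iUnion, h, thickening_iUnion] at e1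
  rw [h2] at e2
  exact ⟨e1.trans e2.symm⟩

/-! ### Voronoi balls -/

theorem isClosed_voronoiCell {M : Type*} [MetricSpace M] (X : Finset M) (x : M) :
    IsClosed (voronoiCell X x) := by
  simp only [voronoiCell, ofPred_forall]
  exact isClosed_biInter fun x' _ => isClosed_le (by fun_prop) (by fun_prop)

theorem isCompact_voronoiBall {M : Type*} [MetricSpace M] [ProperSpace M] (r : ℝ) (X : Finset M)
    (x : M) : IsCompact (voronoiBall r X x) :=
  (isCompact_closedBall x r).inter_right (isClosed_voronoiCell X x)

/-- The points at least as close to `x` as to `y` form a half-space. -/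
theorem convex_setOf_dist_le_dist {E : Type*} [NormedAddCommGroup E] [InnerProductSpace ℝ E]
    (x y : E) : Convex ℝ {z | dist x z ≤ dist y z} := by
  have : {z | dist x z ≤ dist y z} =
      {z | inner ℝ (y - x) z ≤ (‖y‖ ^ 2 - ‖x‖ ^ 2) / 2} := by
    ext z
    rw [mem_ofPred_eq, mem_ofPred_eq, dist_eq_norm, dist_eq_norm,
      ← sq_le_sq₀ (norm_nonneg _) (norm_nonneg _), norm_sub_sq_real, norm_sub_sq_real,
      inner_sub_left]
    constructor <;> intro h <;> linarith
  rw [this]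
  exact convex_halfSpace_le (innerₗ E (y - x)).isLinear _

theorem convex_voronoiBall {E : Type*} [NormedAddCommGroup E] [InnerProductSpace ℝ E] (r : ℝ)
    (X : Finset E) (x : E) : Convex ℝ (voronoiBall r X x) := by
  refine (convex_closedBall x r).inter ?_
  simp only [voronoiCell, ofPred_forall]
  exact convex_iInter₂ fun y _ => convex_setOf_dist_le_dist x y

/-- The Voronoi balls of a finite set cover the same points as its closed balls: a point of some
closed ball lies in the Voronoi ball of a nearest center. -/
theorem iUnion_voronoiBall {M : Type*} [MetricSpace M] (r : ℝ) (X : Finset M) :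
    ⋃ x : X, voronoiBall r X (x : M) = ⋃ x ∈ X, closedBall x r := by
  ext z
  simp only [mem_iUnion, exists_prop]
  constructor
  · rintro ⟨x, hx⟩
    exact ⟨x, x.2, hx.1⟩
  · rintro ⟨x, hx, hz⟩
    obtain ⟨y, hy, hmin⟩ := X.exists_min_image (fun y => dist y z) ⟨x, hx⟩
    refine ⟨⟨y, hy⟩, ?_, hmin⟩
    rw [mem_closedBall, dist_comm] at hz ⊢
    exact (hmin x hx).trans hz

end CoupledAlpha

theorem mainTheorem1 (d : ℕ) [DecidableEq (EuclideanSpace ℝ (Fin d))]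
    (X Y : Finset (EuclideanSpace ℝ (Fin d))) (r : ℝ) (hr : 0 ≤ r) :
    Nonempty
      (↥(CoupledAlpha.realization (CoupledAlpha.coupledAlphaComplex r X Y)) ≃ₕ
        ↥(CoupledAlpha.realization (CoupledAlpha.alphaComplex r (X ∪ Y)))) := by
  refine CoupledAlpha.nonempty_homotopyEquiv_realization_nerve_of_iUnion_eq ?_ ?_
    (fun z => CoupledAlpha.isCompact_voronoiBall r _ _)
    (fun z => CoupledAlpha.convex_voronoiBall r _ _) ?_
  · rintro (x | y) <;> exact CoupledAlpha.isCompact_voronoiBall r _ _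
  · rintro (x | y) <;> exact CoupledAlpha.convex_voronoiBall r _ _
  · rw [Set.iUnion_sum]
    simp only [Sum.elim_inl, Sum.elim_inr]
    rw [CoupledAlpha.iUnion_voronoiBall, CoupledAlpha.iUnion_voronoiBall,
      CoupledAlpha.iUnion_voronoiBall, Finset.set_biUnion_union]
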